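/- A Fréchet space is a complex vector space with a complete Hausdorff topology given by an increasing sequence of seminorms. It is nuclear if every continuous seminorm $p$ is dominated by a continuous seminorm $q$ such that the canonical map of normed spaces $E/q^{-1}(0)\to E/p^{-1}(0)$ is nuclear, i.e. of the form $x\mapsto\sum_k f_k(x)\,y_k$ with $\sum_k\|f_k\|\,\|y_k\|<\infty$. A Fréchet ideal of a Banach algebra $B$ is an ideal $A\subseteq B$ with a Fréchet space topology of its own for which the inclusion $A\hookrightarrow B$ is continuous and the multiplications $A\times A\to A$, $A\times B\to A$ and $B\times A\to A$ are jointly continuous. It is a dense nuclear Fréchet ideal if moreover $A$ is dense in $B$ for the norm of $B$ and $A$ is nuclear as a Fréchet space. **Theorem 4.3.** Let $B$ be a commutative $C^*$-algebra (not necessarily unital) with maximal ideal space $M$, that is, the space of nonzero characters of $B$ with the weak-$*$ topology. 1. $B$ has a dense nuclear Fréchet ideal if and only if $M$ is discrete and countable (finite or countably infinite). 2. If $M$ is discrete and countably infinite, then the Gelfand transform $b\mapsto(m\mapsto m(b))$ is a $*$-isomorphism of $B$ onto $c_0(M)$. 3. For every countably infinite discrete set $X$ and every bijection $\gamma\colon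 X\to\{1,2,3,\dots\}$, the space of standard Schwartz functions $$\mathcal S_\gamma(X)=\Bigl\{\varphi\colon X\to\mathbb C \;\Big|\; \|\varphi\|_n=\sup_{x\in X}\gamma(x)^n|\varphi(x)|<\infty\ \text{ for } n=0,1,2,\dots\Bigr\},$$ topologized by the norms $\|\cdot\|_n$, is contained in $c_0(X)$ and is a dense nuclear Fréchet ideal of $c_0(X)$ (pointwise multiplication, sup-norm). -/

import Mathlib

open Filter Topology
open scoped ZeroAtInfty

noncomputable section

/-- For seminorms `q`, `p` on a complex vector space `E`, let `E_q = E / q⁻¹(0)` and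
`E_p = E / p⁻¹(0)` be the associated normed spaces. The canonical map `E_q → E_p` is nuclear:
it is `x ↦ ∑ k, f k x • y k`, where `f k` is a bounded functional on `E_q`
(a functional on `E` with `‖f k x‖ ≤ c k * q x`), `y k` is (the class of) a vector of `E`,
and `∑ k, c k * p (y k) < ∞`. -/
def Seminorm.IsNuclearPair {E : Type*} [AddCommGroup E] [Module ℂ E]
    (q p : Seminorm ℂ E) : Prop :=
  ∃ (f : ℕ → E →ₗ[ℂ] ℂ) (c : ℕ → ℝ) (y : ℕ → E),
    (∀ k, 0 ≤ c k) ∧ (∀ k x, ‖f k x‖ ≤ c k * q x) ∧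
    Summable (fun k => c k * p (y k)) ∧
    ∀ x, Tendsto (fun N => p (x - ∑ k ∈ Finset.range N, f k x • y k)) atTop (𝓝 0)

/-- Nuclearity (in the sense of Grothendieck and Pietsch) of a locally convex space `E`: every
continuous seminorm `p` is dominated by a continuous seminorm `q` for which the canonical map
`E_q → E_p` is nuclear. -/
def IsNuclearSpace (E : Type*) [AddCommGroup E] [Module ℂ E] [TopologicalSpace E] : Prop :=
  ∀ p : Seminorm ℂ E, Continuous p →
    ∃ q : Seminorm ℂ E, Continuous q ∧ p ≤ q ∧ q.IsNuclearPair p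

/-- A Fréchet space over `ℂ`: the topology is given by an increasing sequence of seminorms, it is
Hausdorff, and it is complete. -/
def IsFrechetSpace (E : Type*) [AddCommGroup E] [Module ℂ E] [TopologicalSpace E] : Prop :=
  T2Space E ∧
  ∃ p : SeminormFamily ℂ E ℕ, Monotone p ∧ WithSeminorms p ∧
    ∀ u : ℕ → E,
      (∀ n, ∀ ε > 0, ∃ N, ∀ i ≥ N, ∀ j ≥ N, p n (u i - u j) < ε) →
      ∃ x, Tendsto u atTop (𝓝 x)

section Ideal

variable {B : Type*} [NonUnitalNormedRing B] [NormedSpace ℂ B]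

/-- `A`, with its own topology `τ` (in general not the one inherited from `B`), is a (two-sided)
Fréchet ideal of the Banach algebra `B`. -/
structure IsFrechetIdeal (A : NonUnitalSubalgebra ℂ B) (τ : TopologicalSpace A) : Prop where
  /-- `A` is a Fréchet space. -/
  frechet : @IsFrechetSpace A _ _ τ
  /-- The multiplication of `A` is jointly continuous. -/
  continuous_mul : Continuous[@instTopologicalSpaceProd A A τ τ, τ] fun x : A × A => x.1 * x.2
  /-- The inclusion of `A` in `B` is continuous. -/
  continuous_incl : Continuous[τ, inferInstance] fun a : A => (a : B)
  mul_mem_right : ∀ (a : A) (b : B), (a : B) * b ∈ A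
  mul_mem_left : ∀ (a : A) (b : B), b * (a : B) ∈ A
  /-- The multiplication `A × B → A` is jointly continuous. -/
  continuous_mul_right :
    Continuous[@instTopologicalSpaceProd A B τ inferInstance, τ]
      fun x : A × B => (⟨(x.1 : B) * x.2, mul_mem_right x.1 x.2⟩ : A)
  /-- The multiplication `(a, b) ↦ b * a` into `A` is jointly continuous. -/
  continuous_mul_left :
    Continuous[@instTopologicalSpaceProd A B τ inferInstance, τ]
      fun x : A × B => (⟨x.2 * (x.1 : B), mul_mem_left x.1 x.2⟩ : A)

/-- `A`, with the topology `τ`, is a dense nuclear Fréchet ideal of `B`. -/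
structure IsDenseNuclearFrechetIdeal (A : NonUnitalSubalgebra ℂ B) (τ : TopologicalSpace A) :
    Prop extends IsFrechetIdeal A τ where
  dense : Dense (A : Set B)
  nuclear : @IsNuclearSpace A _ _ τ

end Ideal

section Schwartz

variable {X : Type*}

/-- The standard Schwartz functions on `X` for the enumeration `γ`: all `φ : X → ℂ` with
`sup_x γ(x)^n |φ(x)| < ∞` for every `n`. -/
def IsSchwartzFunction (γ : X ≃ ℕ+) (φ : X → ℂ) : Prop :=
  ∀ n : ℕ, BddAbove (Set.range fun x => ((γ x : ℕ) : ℝ) ^ n * ‖φ x‖)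

theorem IsSchwartzFunction.add {γ : X ≃ ℕ+} {φ ψ : X → ℂ} (hφ : IsSchwartzFunction γ φ)
    (hψ : IsSchwartzFunction γ ψ) : IsSchwartzFunction γ (φ + ψ) := by
  intro n
  obtain ⟨C, hC⟩ := hφ n
  obtain ⟨D, hD⟩ := hψ n
  refine ⟨C + D, ?_⟩
  rintro _ ⟨x, rfl⟩
  have h1 := hC ⟨x, rfl⟩
  have h2 := hD ⟨x, rfl⟩
  have h3 : ((γ x : ℕ) : ℝ) ^ n * ‖(φ + ψ) x‖ ≤ ((γ x : ℕ) : ℝ) ^ n * (‖φ x‖ + ‖ψ x‖) :=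
    mul_le_mul_of_nonneg_left (norm_add_le _ _) (by positivity)
  simp only at h1 h2 ⊢
  linarith

theorem IsSchwartzFunction.smul {γ : X ≃ ℕ+} {φ : X → ℂ} (hφ : IsSchwartzFunction γ φ) (r : ℂ) :
    IsSchwartzFunction γ (r • φ) := by
  intro n
  obtain ⟨C, hC⟩ := hφ n
  refine ⟨‖r‖ * C, ?_⟩
  rintro _ ⟨x, rfl⟩
  have h1 := mul_le_mul_of_nonneg_left (hC ⟨x, rfl⟩) (norm_nonneg r)
  simp only [Pi.smul_apply, smul_eq_mul, norm_mul] at h1 ⊢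
  linarith

theorem IsSchwartzFunction.mul {γ : X ≃ ℕ+} {φ ψ : X → ℂ} (hφ : IsSchwartzFunction γ φ)
    (hψ : IsSchwartzFunction γ ψ) : IsSchwartzFunction γ (φ * ψ) := by
  intro n
  obtain ⟨C, hC⟩ := hφ n
  obtain ⟨D, hD⟩ := hψ 0
  refine ⟨C * D, ?_⟩
  rintro _ ⟨x, rfl⟩
  have h1 := hC ⟨x, rfl⟩
  have h2 := hD ⟨x, rfl⟩
  simp only [Pi.mul_apply, norm_mul, pow_zero, one_mul] at h1 h2 ⊢
  have h0 : 0 ≤ ((γ x : ℕ) : ℝ) ^ n * ‖φ x‖ := by positivity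
  rw [← mul_assoc]
  exact mul_le_mul h1 h2 (norm_nonneg _) (h0.trans h1)

variable [TopologicalSpace X]

/-- The standard Schwartz functions as a subalgebra of `c₀(X)` (`X` discrete). -/
def schwartzSubalgebra (γ : X ≃ ℕ+) : NonUnitalSubalgebra ℂ C₀(X, ℂ) where
  carrier := {φ | IsSchwartzFunction γ φ}
  zero_mem' n := ⟨0, by rintro _ ⟨x, rfl⟩; simp⟩
  add_mem' hφ hψ := IsSchwartzFunction.add hφ hψ
  mul_mem' hφ hψ := IsSchwartzFunction.mul hφ hψ
  smul_mem' r _ hφ := IsSchwartzFunction.smul hφ r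

/-- The sup-norms `‖φ‖_n = sup_x γ(x)^n |φ(x)|` on the standard Schwartz functions. -/
def schwartzNorm (γ : X ≃ ℕ+) : SeminormFamily ℂ (schwartzSubalgebra γ) ℕ := fun n =>
  Seminorm.of (fun φ => ⨆ x, ((γ x : ℕ) : ℝ) ^ n * ‖(φ : C₀(X, ℂ)) x‖)
    (fun φ ψ => by
      refine Real.iSup_le (fun x => ?_) (add_nonneg
        (Real.iSup_nonneg fun x => by positivity) (Real.iSup_nonneg fun x => by positivity))
      have h1 := le_ciSup (φ.2 n) x
      have h2 := le_ciSup (ψ.2 n) x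
      have h3 := mul_le_mul_of_nonneg_left
        (norm_add_le ((φ : C₀(X, ℂ)) x) ((ψ : C₀(X, ℂ)) x))
        (by positivity : 0 ≤ ((γ x : ℕ) : ℝ) ^ n)
      rw [mul_add] at h3
      exact h3.trans (add_le_add h1 h2))
    (fun r φ => by
      rw [Real.mul_iSup_of_nonneg (norm_nonneg r)]
      refine congrArg _ (funext fun x => ?_)
      have : ((r • φ : schwartzSubalgebra γ) : C₀(X, ℂ)) x = r * (φ : C₀(X, ℂ)) x := rfl
      rw [this, norm_mul]
      ring)

/-- The Fréchet topology of the standard Schwartz functions, given by the norms `‖·‖_n`. -/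
@[reducible]
def schwartzTopology (γ : X ≃ ℕ+) : TopologicalSpace (schwartzSubalgebra γ) :=
  (schwartzNorm γ).moduleFilterBasis.topology

end Schwartz

end

/-! Gelfand theory is reduced to the unital case: the character space of the unitization is the
one-point compactification of `M`, and `B` is the ideal of functions vanishing at infinity.

Necessity: nuclearity for the norm of `B` writes the inclusion as `x = ∑ f_k(x) y_k`. For fixed `e ∈
A`, `b ↦ e b` is continuous from `B` to `A`, so multiplication by `e` is a nuclear, hence compact,
operator on `B`. On `C₀(M)` this forces `{m | δ ≤ |m(e)|}` to be finite for all `δ > 0`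
(`finite_setOf_le_norm_apply`). By density no character vanishes on `A`, so each has a finite
neighbourhood, and `M` is Hausdorff, hence discrete. No character kills all the `y_k` either, so `M`
is a countable union of finite sets.

Sufficiency: for discrete `X` with an injective weight `w : X → {1, 2, …}`, the rapidly decreasing
functions form the ideal. They are nuclear because `a = ∑ a(x) e_x` with `e_x` the point masses, and
passing from `p (n + 2)` to `p n` gains the summable factor `w(x)⁻²`. `IsRapidlyDecreasing` treats
`𝓢_γ(X)` and the ideal of `B` together. -/

namespace WeakDual.CharacterSpace

/-! ### Gelfand duality without unit -/

variable {B : Type*} [NonUnitalCommCStarAlgebra B]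

/-- The extension of a character of `B` to the unitization of `B`. -/
noncomputable def unitizationExtend (m : characterSpace ℂ B) :
    characterSpace ℂ (Unitization ℂ B) :=
  equivAlgHom.symm (Unitization.lift (toNonUnitalAlgHom m))

/-- The character of the unitization of `B` that vanishes on `B`. -/
noncomputable def unitizationInfty (B : Type*) [NonUnitalCommCStarAlgebra B] :
    characterSpace ℂ (Unitization ℂ B) :=
  equivAlgHom.symm (Unitization.lift 0)

@[simp]
theorem unitizationExtend_apply (m : characterSpace ℂ B) (x : Unitization ℂ B) :
    unitizationExtend m x = x.fst + m x.snd := by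
  simp [unitizationExtend, Unitization.lift]

@[simp]
theorem unitizationInfty_apply (x : Unitization ℂ B) : unitizationInfty B x = x.fst := by
  simp [unitizationInfty, Unitization.lift]

theorem norm_apply_le (m : characterSpace ℂ B) (b : B) : ‖m b‖ ≤ ‖b‖ := by
  have h := spectrum.norm_le_norm_of_mem
    (apply_mem_spectrum (unitizationExtend m) (b : Unitization ℂ B))
  simpa [Unitization.norm_inr] using h

theorem map_star_of_nonUnital (m : characterSpace ℂ B) (b : B) : m (star b) = star (m b) := by
  have h := map_star (unitizationExtend m) (b : Unitization ℂ B)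
  simpa [← Unitization.inr_star] using h

/-- The restriction to `B` of a character of the unitization of `B`. -/
noncomputable def unitizationRestrict (χ : characterSpace ℂ (Unitization ℂ B)) : WeakDual ℂ B :=
  (toCLM χ).comp ((Unitization.inrHom ℂ ℂ B).mkContinuous 1 fun b => by
    simp [Unitization.norm_inr])

theorem apply_eq_fst_add (χ : characterSpace ℂ (Unitization ℂ B)) (x : Unitization ℂ B) :
    χ x = x.fst + χ (x.snd : Unitization ℂ B) := by
  have h := map_add χ (algebraMap ℂ (Unitization ℂ B) x.fst) (x.snd : Unitization ℂ B)
  rwa [AlgHomClass.commutes, Unitization.algebraMap_eq_inl,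
    Unitization.inl_fst_add_inr_snd_eq] at h

/-- Restriction to `B` is a continuous left inverse. It takes values in the weak dual, since the
character at infinity restricts to zero. -/
theorem isEmbedding_unitizationExtend :
    IsEmbedding (unitizationExtend : characterSpace ℂ B → _) := by
  have hr : Continuous (unitizationRestrict (B := B)) := continuous_of_continuous_eval fun b =>
    (eval_continuous (b : Unitization ℂ B)).comp continuous_subtype_val
  have hc : Continuous (unitizationExtend : characterSpace ℂ B → _) := by
    refine Continuous.subtype_mk (continuous_of_continuous_eval fun x => ?_) _
    refine Continuous.congr (f := fun m : characterSpace ℂ B => x.fst + m x.snd) ?_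
      fun m => (unitizationExtend_apply m x).symm
    exact continuous_const.add ((eval_continuous x.snd).comp continuous_subtype_val)
  refine IsEmbedding.of_comp hc hr ?_
  convert! IsEmbedding.subtypeVal (p := fun φ => φ ∈ characterSpace ℂ B) using 1
  funext m
  refine DFunLike.ext _ _ fun b => ?_
  show unitizationExtend m (b : Unitization ℂ B) = m b
  simp

theorem range_unitizationExtend :
    Set.range (unitizationExtend : characterSpace ℂ B → _) = {unitizationInfty B}ᶜ := by
  ext χ
  constructor
  · rintro ⟨m, rfl⟩ h
    refine m.2.1 (DFunLike.ext _ _ fun b => ?_)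
    have := DFunLike.congr_fun (Set.mem_singleton_iff.1 h) (b : Unitization ℂ B)
    simp only [unitizationExtend_apply, unitizationInfty_apply, Unitization.fst_inr,
      Unitization.snd_inr, zero_add] at this
    exact this
  · intro h
    refine ⟨⟨unitizationRestrict χ, fun h0 => h ?_, fun x y => ?_⟩, ?_⟩
    · ext x
      have h1 : χ (x.snd : Unitization ℂ B) = 0 := DFunLike.congr_fun h0 x.snd
      rw [apply_eq_fst_add, h1, add_zero, unitizationInfty_apply]
    · show χ ((x * y : B) : Unitization ℂ B) = χ x * χ y
      rw [Unitization.inr_mul, map_mul]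
    · ext x
      rw [unitizationExtend_apply, apply_eq_fst_add χ]
      rfl

/-- The character space of the unitization is the one-point compactification of the
character space. -/
noncomputable def onePointHomeomorph (B : Type*) [NonUnitalCommCStarAlgebra B] :
    OnePoint (characterSpace ℂ B) ≃ₜ characterSpace ℂ (Unitization ℂ B) :=
  OnePoint.equivOfIsEmbeddingOfRangeEq (unitizationInfty B) unitizationExtend
    isEmbedding_unitizationExtend range_unitizationExtend

instance instT2SpaceNonUnital : T2Space (characterSpace ℂ B) :=
  (isEmbedding_unitizationExtend (B := B)).t2Space

/-- On the one-point compactification the transform of `b` is continuous with value `0` at infinity.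
-/
theorem tendsto_apply_cocompact (b : B) :
    Tendsto (fun m : characterSpace ℂ B => m b) (cocompact (characterSpace ℂ B)) (𝓝 0) := by
  rw [← coclosedCompact_eq_cocompact]
  have h1 := ((gelfandTransform ℂ (Unitization ℂ B) (b : Unitization ℂ B)).continuous.comp
    (onePointHomeomorph B).continuous).tendsto OnePoint.infty
  have h2 := h1.comp (OnePoint.tendsto_coe_infty (X := characterSpace ℂ B))
  convert! h2 using 1
  · funext m
    show m b = unitizationExtend m (b : Unitization ℂ B)
    simp
  · show _ = 𝓝 (unitizationInfty B (b : Unitization ℂ B))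
    simp

/-- Every continuous function on the character space of the unitization that vanishes at infinity
comes from an element of the algebra with the same norm. -/
theorem exists_apply_eq_of_continuousMap (g : C(characterSpace ℂ (Unitization ℂ B), ℂ))
    (hg : g (unitizationInfty B) = 0) :
    ∃ b : B, ‖b‖ = ‖g‖ ∧ ∀ m : characterSpace ℂ B, m b = g (unitizationExtend m) := by
  obtain ⟨u, rfl⟩ := (gelfandTransform_bijective (Unitization ℂ B)).2 g
  have h0 : u.fst = 0 := by
    rw [← unitizationInfty_apply]; exact hg
  have hu : (u.snd : Unitization ℂ B) = u := by
    conv_rhs => rw [← Unitization.inl_fst_add_inr_snd_eq u, h0]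
    simp
  refine ⟨u.snd, ?_, fun m => ?_⟩
  · rw [(gelfandTransform_isometry (Unitization ℂ B)).norm_map_of_map_zero (map_zero _),
      ← Unitization.norm_inr (𝕜 := ℂ), hu]
  · show _ = unitizationExtend m u
    simp [h0]

/-- The Gelfand transform of a commutative C⋆-algebra that need not be unital. -/
noncomputable def gelfandTransformHom (B : Type*) [NonUnitalCommCStarAlgebra B] :
    B →⋆ₙₐ[ℂ] C₀(characterSpace ℂ B, ℂ) where
  toFun b :=
    { toFun := fun m => m b
      continuous_toFun := (eval_continuous b).comp continuous_subtype_val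
      zero_at_infty' := tendsto_apply_cocompact b }
  map_smul' r b := by ext m; exact map_smul m r b
  map_zero' := by ext m; exact map_zero m
  map_add' a b := by ext m; exact map_add m a b
  map_mul' a b := by ext m; exact map_mul m a b
  map_star' b := by ext m; exact map_star_of_nonUnital m b

/-- Both halves come from the unitization: elements of `B` vanish at the extra character, and `f`
extends by `0` to the one-point compactification. -/
theorem gelfandTransformHom_bijective : Function.Bijective (gelfandTransformHom B) := by
  constructor
  · rw [injective_iff_map_eq_zero]
    intro b hb
    have h : (b : Unitization ℂ B) = 0 := by
      apply (gelfandTransform_bijective (Unitization ℂ B)).1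
      ext χ
      obtain rfl | h := eq_or_ne χ (unitizationInfty B)
      · show unitizationInfty B (b : Unitization ℂ B) = unitizationInfty B 0
        simp
      · obtain ⟨m, rfl⟩ : χ ∈ Set.range unitizationExtend := by rwa [range_unitizationExtend]
        have : m b = 0 := DFunLike.congr_fun hb m
        show unitizationExtend m (b : Unitization ℂ B) = unitizationExtend m 0
        simp [this]
    exact Unitization.inr_injective (h.trans (Unitization.inr_zero ℂ).symm)
  · intro f
    let g : C(OnePoint (characterSpace ℂ B), ℂ) := OnePoint.continuousMapMk f.toContinuousMap 0
      (by rw [coclosedCompact_eq_cocompact]; exact f.zero_at_infty')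
    let e : C(characterSpace ℂ (Unitization ℂ B), OnePoint (characterSpace ℂ B)) :=
      ⟨(onePointHomeomorph B).symm, (onePointHomeomorph B).symm.continuous⟩
    have he : ∀ m : characterSpace ℂ B, e (unitizationExtend m) = m := fun m =>
      (onePointHomeomorph B).symm_apply_apply (m : OnePoint _)
    have he' : e (unitizationInfty B) = OnePoint.infty :=
      (onePointHomeomorph B).symm_apply_apply OnePoint.infty
    obtain ⟨b, -, hb⟩ := exists_apply_eq_of_continuousMap (g.comp e) (by
      rw [ContinuousMap.comp_apply, he']; rfl)
    refine ⟨b, ZeroAtInftyContinuousMap.ext fun m => ?_⟩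
    show m b = f m
    rw [hb, ContinuousMap.comp_apply, he]
    rfl

/-- The Gelfand transform of a commutative C⋆-algebra is a ⋆-isomorphism onto the continuous
functions vanishing at infinity on the character space. -/
noncomputable def gelfandTransformEquiv (B : Type*) [NonUnitalCommCStarAlgebra B] :
    B ≃⋆ₐ[ℂ] C₀(characterSpace ℂ B, ℂ) :=
  StarAlgEquiv.ofBijective (gelfandTransformHom B) gelfandTransformHom_bijective

theorem gelfandTransformEquiv_apply (b : B) (m : characterSpace ℂ B) :
    gelfandTransformEquiv B b m = m b := rfl

/-- Urysohn on the compact character space of the unitization; requiring the value `0` at infinity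
too puts the function in `B`. -/
theorem exists_norm_le_one_of_ne {m m' : characterSpace ℂ B} (h : m ≠ m') :
    ∃ b : B, ‖b‖ ≤ 1 ∧ m b = 1 ∧ m' b = 0 := by
  have hm : unitizationExtend m ≠ unitizationInfty B := by
    have := Set.mem_range_self (f := unitizationExtend) m
    rwa [range_unitizationExtend] at this
  have hm' : unitizationExtend m ≠ unitizationExtend m' :=
    isEmbedding_unitizationExtend.injective.ne h
  obtain ⟨f, hf0, hf1, hf⟩ := exists_continuous_zero_one_of_isClosed
    (s := {unitizationInfty B, unitizationExtend m'}) (t := {unitizationExtend m})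
    (Set.toFinite _).isClosed isClosed_singleton (by simp [hm, hm'])
  obtain ⟨b, hbn, hb⟩ := exists_apply_eq_of_continuousMap
    (B := B) ((⟨Complex.ofReal, Complex.continuous_ofReal⟩ : C(ℝ, ℂ)).comp f) (by
      simp [hf0 (Set.mem_insert _ _)])
  refine ⟨b, ?_, ?_, ?_⟩
  · rw [hbn, ContinuousMap.norm_le _ zero_le_one]
    intro χ
    simpa [abs_of_nonneg (hf χ).1] using (hf χ).2
  · rw [hb]
    simp [hf1 (Set.mem_singleton _)]
  · rw [hb]
    simp [hf0 (Set.mem_insert_of_mem _ (Set.mem_singleton _))]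

end WeakDual.CharacterSpace

/-! ### Necessity: nuclearity forces `M` to be discrete and countable -/

section Necessity

open WeakDual WeakDual.CharacterSpace

variable {B : Type*} [NonUnitalCommCStarAlgebra B]

/-- Nuclearity of a Fréchet ideal, applied to the norm of the ambient algebra: the inclusion is a
sum of rank-one operators, and so are all the multiplication operators by elements of the ideal. -/
theorem IsDenseNuclearFrechetIdeal.exists_rankOne_expansion {A : NonUnitalSubalgebra ℂ B}
    {τ : TopologicalSpace A} (h : IsDenseNuclearFrechetIdeal A τ) :
    ∃ (f : ℕ → A →ₗ[ℂ] ℂ) (c : ℕ → ℝ) (y : ℕ → A),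
      (∀ k, 0 ≤ c k) ∧ Summable (fun k => c k * ‖(y k : B)‖) ∧
      (∀ e : A, ∃ D : ℝ, 0 < D ∧
        ∀ k (b : B), ‖f k ⟨e * b, h.mul_mem_right e b⟩‖ ≤ c k * (D * ‖b‖)) ∧
      ∀ x : A, Tendsto (fun N => ∑ k ∈ Finset.range N, f k x • (y k : B)) atTop (𝓝 (x : B)) := by
  obtain ⟨q, hq, -, f, c, y, hc, hf, hs, ht⟩ := h.nuclear
    ((normSeminorm ℂ B).comp (NonUnitalSubalgebraClass.subtype A : A →ₗ[ℂ] B))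
    (continuous_norm.comp h.continuous_incl)
  refine ⟨f, c, y, hc, hs, fun e => ?_, fun x => ?_⟩
  · let L : B →ₗ[ℂ] A :=
      { toFun := fun b => ⟨e * b, h.mul_mem_right e b⟩
        map_add' := fun a b => Subtype.ext (mul_add _ _ _)
        map_smul' := fun r b => Subtype.ext (mul_smul_comm _ _ _) }
    -- A continuous seminorm on a normed space is bounded by a multiple of the norm; this yields one
    -- `D` for all `k`.
    have hL : Continuous (q.comp L) := by
      have h1 := @Continuous.comp _ _ _ _ (@instTopologicalSpaceProd A B τ inferInstance) τ
        (fun b : B => (e, b)) _ h.continuous_mul_right (by fun_prop)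
      exact hq.comp h1
    obtain ⟨D, hD, hDb⟩ := Seminorm.bound_of_continuous_normedSpace (q.comp L) hL
    exact ⟨D, hD, fun k b => (hf k _).trans (mul_le_mul_of_nonneg_left (hDb b) (hc k))⟩
  · rw [tendsto_iff_norm_sub_tendsto_zero]
    refine (ht x).congr fun N => ?_
    rw [norm_sub_rev]
    show ‖((x - ∑ k ∈ Finset.range N, f k x • y k : A) : B)‖ = _
    simp

/-- An infinite set of characters contains two distinct ones that are close at finitely many
given elements. -/
theorem WeakDual.CharacterSpace.exists_ne_forall_norm_sub_lt {K : Set (characterSpace ℂ B)}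
    (hK : K.Infinite) (y : ℕ → B) (N : ℕ) {η : ℝ} (hη : 0 < η) :
    ∃ m ∈ K, ∃ m' ∈ K, m ≠ m' ∧ ∀ k < N, ‖m (y k) - m' (y k)‖ < η := by
  let F : characterSpace ℂ B → (Fin N → ℂ) := fun m k => m (y k)
  have hb : TotallyBounded (Set.range F) := by
    refine (ProperSpace.isCompact_closedBall (0 : Fin N → ℂ)
      (∑ k : Fin N, ‖y k‖)).totallyBounded.subset ?_
    rintro _ ⟨m, rfl⟩
    rw [mem_closedBall_zero_iff, pi_norm_le_iff_of_nonneg (by positivity)]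
    intro k
    exact (norm_apply_le m _).trans
      (Finset.single_le_sum (f := fun k : Fin N => ‖y k‖) (fun _ _ => norm_nonneg _)
        (Finset.mem_univ k))
  obtain ⟨t, ht, hcov⟩ := Metric.totallyBounded_iff.1 hb (η / 2) (half_pos hη)
  have hex : ∀ m, ∃ z ∈ t, dist (F m) z < η / 2 := fun m => by
    simpa using hcov (Set.mem_range_self m)
  choose z hzt hz using hex
  -- Pigeonhole: infinitely many characters share finitely many ball centres.
  obtain ⟨m, hm, m', hm', hne, heq⟩ := hK.exists_ne_map_eq_of_mapsTo (f := z)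
    (fun m _ => hzt m) ht
  refine ⟨m, hm, m', hm', hne, fun k hk => ?_⟩
  have h1 : dist (F m) (F m') < η := by
    have := dist_triangle_right (F m) (F m') (z m)
    have h2 := hz m
    have h3 := hz m'
    rw [← heq] at h3
    linarith
  rw [← dist_eq_norm]
  exact (dist_le_pi_dist (F m) (F m') ⟨k, hk⟩).trans_lt h1

/-- If the set were infinite, it would contain `m` and some `m' ≠ m` nearly equal on the first `N`
vectors `y_k`. With `m(b) = 1` and `m'(b) = 0`, the expansion of `e b` would make `m(e b) - m'(e b)
= m(e)` smaller than `δ`. -/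
theorem IsDenseNuclearFrechetIdeal.finite_setOf_le_norm_apply {A : NonUnitalSubalgebra ℂ B}
    {τ : TopologicalSpace A} (h : IsDenseNuclearFrechetIdeal A τ) (e : A) {δ : ℝ} (hδ : 0 < δ) :
    {m : characterSpace ℂ B | δ ≤ ‖m e‖}.Finite := by
  by_contra hK
  obtain ⟨f, c, y, hc, hs, hD, ht⟩ := h.exists_rankOne_expansion
  obtain ⟨D, hD0, hD⟩ := hD e
  -- The tail is at most `2D · δ/(8D) = δ/4`, since characters are contractive.
  obtain ⟨N, hN⟩ := ((tendsto_order.1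
    (tendsto_sum_nat_add fun k => c k * ‖(y k : B)‖)).2 (δ / (8 * D)) (by positivity)).exists
  set S : ℝ := ∑ k ∈ Finset.range N, c k with hS
  have hS0 : 0 ≤ S := Finset.sum_nonneg fun k _ => hc k
  -- The head is at most `S · D · η ≤ δ/4`; `S + 1` avoids dividing by zero.
  obtain ⟨m, hm, m', -, hne, hclose⟩ := exists_ne_forall_norm_sub_lt hK (fun k => (y k : B)) N
    (η := δ / (4 * D * (S + 1))) (by positivity)
  obtain ⟨b, hb, hmb, hmb'⟩ := exists_norm_le_one_of_ne hne
  set x : A := ⟨e * b, h.mul_mem_right e b⟩ with hx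
  have hfx : ∀ k, ‖f k x‖ ≤ c k * D := fun k => (hD k b).trans
    (mul_le_mul_of_nonneg_left (mul_le_of_le_one_right hD0.le hb) (hc k))
  have hlim : Tendsto (fun n => ‖∑ k ∈ Finset.range n, f k x * (m (y k) - m' (y k))‖) atTop
      (𝓝 ‖m e‖) := by
    have h1 := ((map_continuous m).tendsto _).comp (ht x)
    have h2 := ((map_continuous m').tendsto _).comp (ht x)
    have h3 := (h1.sub h2).norm
    have h4 : m (x : B) - m' (x : B) = m e := by
      simp [hx, map_mul, hmb, hmb']
    rw [h4] at h3
    refine h3.congr fun n => ?_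
    simp [mul_sub]
  have hbound : ∀ n, ‖∑ k ∈ Finset.range (n + N), f k x * (m (y k) - m' (y k))‖ ≤ δ / 2 := by
    intro n
    rw [add_comm, Finset.sum_range_add]
    have hA : ‖∑ k ∈ Finset.range N, f k x * (m (y k) - m' (y k))‖ ≤ δ / 4 := by
      calc _ ≤ ∑ k ∈ Finset.range N, c k * D * (δ / (4 * D * (S + 1))) := by
            refine norm_sum_le_of_le _ fun k hk => ?_
            rw [norm_mul]
            exact mul_le_mul (hfx k) (hclose k (Finset.mem_range.1 hk)).le (norm_nonneg _)
              (mul_nonneg (hc k) hD0.le)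
        _ = S / (S + 1) * (δ / 4) := by
            rw [← Finset.sum_mul, ← Finset.sum_mul, ← hS]
            field_simp
        _ ≤ 1 * (δ / 4) := by
            refine mul_le_mul_of_nonneg_right ?_ (by positivity)
            rw [div_le_one (by positivity)]
            linarith
        _ = δ / 4 := one_mul _
    have hs' : Summable fun k => c (k + N) * ‖(y (k + N) : B)‖ :=
      (summable_nat_add_iff N).2 hs
    have hB : ‖∑ k ∈ Finset.range n, f (N + k) x * (m (y (N + k)) - m' (y (N + k)))‖ ≤ δ / 4 := by
      calc _ ≤ ∑ k ∈ Finset.range n, 2 * D * (c (k + N) * ‖(y (k + N) : B)‖) := by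
            refine norm_sum_le_of_le _ fun k _ => ?_
            rw [norm_mul, add_comm N k]
            have h1 : ‖m (y (k + N)) - m' (y (k + N))‖ ≤ 2 * ‖(y (k + N) : B)‖ := by
              have := norm_sub_le (m (y (k + N) : B)) (m' (y (k + N) : B))
              have := norm_apply_le m (y (k + N) : B)
              have := norm_apply_le m' (y (k + N) : B)
              linarith
            refine (mul_le_mul (hfx _) h1 (norm_nonneg _) (mul_nonneg (hc _) hD0.le)).trans
              (le_of_eq (by ring))
        _ = 2 * D * ∑ k ∈ Finset.range n, c (k + N) * ‖(y (k + N) : B)‖ := by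
            rw [Finset.mul_sum]
        _ ≤ 2 * D * (δ / (8 * D)) := by
            refine mul_le_mul_of_nonneg_left ?_ (by positivity)
            exact (hs'.sum_le_tsum _ fun k _ => mul_nonneg (hc _) (norm_nonneg _)).trans hN.le
        _ = δ / 4 := by field_simp; norm_num
    exact (norm_add_le _ _).trans (by linarith)
  have hle : ‖m e‖ ≤ δ / 2 :=
    le_of_tendsto ((tendsto_add_atTop_iff_nat N).2 hlim) (Eventually.of_forall hbound)
  have hm1 : δ ≤ ‖m e‖ := hm
  linarith

theorem IsDenseNuclearFrechetIdeal.discreteTopology_characterSpace {A : NonUnitalSubalgebra ℂ B}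
    {τ : TopologicalSpace A} (h : IsDenseNuclearFrechetIdeal A τ) :
    DiscreteTopology (characterSpace ℂ B) := by
  refine discreteTopology_iff_isOpen_singleton.2 fun m => ?_
  obtain ⟨e, he⟩ : ∃ e : A, m (e : B) ≠ 0 := by
    by_contra! hcon
    have h0 : (m : B → ℂ) = fun _ => 0 :=
      Continuous.ext_on h.dense (map_continuous m) continuous_const fun a ha => hcon ⟨a, ha⟩
    exact m.2.1 (DFunLike.ext _ _ fun b => congrFun h0 b)
  have hU : IsOpen {m' : characterSpace ℂ B | ‖m e‖ / 2 < ‖m' (e : B)‖} :=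
    isOpen_lt continuous_const
      ((eval_continuous (e : B)).comp continuous_subtype_val).norm
  have hpos : 0 < ‖m (e : B)‖ := norm_pos_iff.2 he
  have hfin : {m' : characterSpace ℂ B | ‖m e‖ / 2 < ‖m' (e : B)‖}.Finite :=
    (h.finite_setOf_le_norm_apply e (half_pos hpos)).subset
      (Set.ofPred_subset_ofPred.2 fun _ hm' => hm'.le)
  -- Removing the other points of the finite neighbourhood isolates `m`.
  have hcl : IsClosed ({m' : characterSpace ℂ B | ‖m e‖ / 2 < ‖m' (e : B)‖} \ {m}) :=
    (hfin.subset Set.sdiff_subset).isClosed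
  convert hU.sdiff hcl using 1
  ext m'
  simp only [Set.mem_singleton_iff, Set.mem_sdiff, Set.mem_ofPred_eq, not_and, not_not]
  constructor
  · rintro rfl
    exact ⟨half_lt_self hpos, fun _ => rfl⟩
  · exact fun h => h.2 h.1

theorem IsDenseNuclearFrechetIdeal.countable_characterSpace {A : NonUnitalSubalgebra ℂ B}
    {τ : TopologicalSpace A} (h : IsDenseNuclearFrechetIdeal A τ) :
    Countable (characterSpace ℂ B) := by
  obtain ⟨f, c, y, -, -, -, ht⟩ := h.exists_rankOne_expansion
  rw [← Set.countable_univ_iff]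
  have hsub : (Set.univ : Set (characterSpace ℂ B)) ⊆
      ⋃ (k : ℕ) (j : ℕ), {m | 1 / ((j : ℝ) + 1) ≤ ‖m (y k : B)‖} := by
    intro m _
    obtain ⟨k, hk⟩ : ∃ k, m (y k : B) ≠ 0 := by
      by_contra! hcon
      have hA : ∀ a : A, m (a : B) = 0 := fun a => by
        have h1 := ((map_continuous m).tendsto _).comp (ht a)
        refine tendsto_nhds_unique h1 (tendsto_const_nhds.congr fun n => ?_)
        simp [hcon]
      have h0 : (m : B → ℂ) = fun _ => 0 :=
        Continuous.ext_on h.dense (map_continuous m) continuous_const fun a ha => hA ⟨a, ha⟩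
      exact m.2.1 (DFunLike.ext _ _ fun b => congrFun h0 b)
    obtain ⟨j, hj⟩ := exists_nat_one_div_lt (norm_pos_iff.2 hk)
    exact Set.mem_iUnion₂.2 ⟨k, j, hj.le⟩
  refine Set.Countable.mono hsub ?_
  exact Set.countable_iUnion fun k => Set.countable_iUnion fun j =>
    (h.finite_setOf_le_norm_apply (y k) (by positivity)).countable

end Necessity

/-! ### Preliminaries on `c₀(X)` and on continuity for seminorm families -/

theorem bddAbove_range_of_finite_support {X : Type*} {φ : X → ℂ} (h : φ.support.Finite)
    (v : X → ℝ) :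
    BddAbove (Set.range fun x => v x * ‖φ x‖) := by
  refine ((h.image fun x => v x * ‖φ x‖).insert 0).bddAbove.mono ?_
  rintro _ ⟨x, rfl⟩
  by_cases hx : φ x = 0
  · simp [hx]
  · exact Set.mem_insert_of_mem _ ⟨x, hx, rfl⟩

section ZeroAtInfty

variable {X : Type*} [TopologicalSpace X]

theorem ZeroAtInftyContinuousMap.norm_apply_le (f : C₀(X, ℂ)) (x : X) : ‖f x‖ ≤ ‖f‖ :=
  f.toBCF.norm_coe_le_norm x

theorem ZeroAtInftyContinuousMap.norm_le_of_forall {f : C₀(X, ℂ)} {C : ℝ} (hC : 0 ≤ C)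
    (h : ∀ x, ‖f x‖ ≤ C) : ‖f‖ ≤ C :=
  (BoundedContinuousFunction.norm_le (f := f.toBCF) hC).2 h

theorem ZeroAtInftyContinuousMap.exists_coe_eq_of_finite_support [DiscreteTopology X] {φ : X → ℂ}
    (h : φ.support.Finite) : ∃ f : C₀(X, ℂ), ⇑f = φ := by
  refine ⟨⟨⟨φ, continuous_of_discreteTopology⟩, ?_⟩, rfl⟩
  rw [cocompact_eq_cofinite]
  refine tendsto_const_nhds.congr' ?_
  filter_upwards [h.compl_mem_cofinite] with x hx
  exact (Function.notMem_support.1 hx).symm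

end ZeroAtInfty

section Continuity

variable {E F : Type*} [AddCommGroup E] [Module ℂ E] [TopologicalSpace E]
  [SeminormedAddCommGroup F] {p : SeminormFamily ℂ E ℕ}

theorem WithSeminorms.continuous_of_norm_le [NormedSpace ℂ F] (hp : WithSeminorms p)
    (L : E →ₗ[ℂ] F) {n : ℕ} (h : ∀ a, ‖L a‖ ≤ p n a) : Continuous L := by
  have := hp.topologicalAddGroup
  refine continuous_of_continuousAt_zero L ?_
  rw [ContinuousAt, map_zero]
  refine squeeze_zero_norm h ?_
  simpa using (hp.continuous_seminorm n).tendsto 0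

theorem WithSeminorms.continuous_of_map_mul_le (hp : WithSeminorms p) (μ : E × F → E)
    (hl : ∀ a a' b, μ (a, b) - μ (a', b) = μ (a - a', b))
    (hr : ∀ a b b', μ (a, b) - μ (a, b') = μ (a, b - b'))
    (hle : ∀ n a b, p n (μ (a, b)) ≤ p n a * ‖b‖) : Continuous μ := by
  have := hp.topologicalAddGroup
  rw [continuous_iff_continuousAt]
  rintro ⟨a₀, b₀⟩
  refine (hp.tendsto_nhds _ _).2 fun n ε hε => ?_
  have hc : Continuous fun z : E × F => p n (z.1 - a₀) * ‖z.2‖ + p n a₀ * ‖z.2 - b₀‖ := by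
    have := hp.continuous_seminorm n
    fun_prop
  have ht := hc.tendsto (a₀, b₀)
  simp only [sub_self, map_zero, zero_mul, norm_zero, mul_zero, add_zero] at ht
  filter_upwards [(tendsto_order.1 ht).2 ε hε] with z hz
  refine lt_of_le_of_lt ?_ hz
  have h1 : μ z - μ (a₀, b₀) = μ (z.1 - a₀, z.2) + μ (a₀, z.2 - b₀) := by
    rw [← hl, ← hr]
    simp
  rw [h1]
  exact (map_add_le_add _ _ _).trans (add_le_add (hle _ _ _) (hle _ _ _))

end Continuity

/-! ### Rapidly decreasing functions on a weighted discrete space -/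

section Weighted

variable {X : Type*} [TopologicalSpace X] {E : Type*} [AddCommGroup E] [Module ℂ E]

/-- `ι` identifies `E` with the space of all `f` in `c₀(X)` for which all the weighted sup-norms
`p n f = sup_x w(x)^n |f(x)|` are finite, where the weight `w` takes distinct positive integer
values. -/
structure IsRapidlyDecreasing (w : X → ℕ) (ι : E →ₗ[ℂ] C₀(X, ℂ)) (p : SeminormFamily ℂ E ℕ) :
    Prop where
  weight_injective : Function.Injective w
  one_le_weight : ∀ x, 1 ≤ w x
  injective : Function.Injective ι
  bddAbove : ∀ a n, BddAbove (Set.range fun x => (w x : ℝ) ^ n * ‖ι a x‖)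
  exists_eq : ∀ f : C₀(X, ℂ), (∀ n, BddAbove (Set.range fun x => (w x : ℝ) ^ n * ‖f x‖)) →
    ∃ a, ι a = f
  seminorm_eq : ∀ n a, p n a = ⨆ x, (w x : ℝ) ^ n * ‖ι a x‖

namespace IsRapidlyDecreasing

variable {w : X → ℕ} {ι : E →ₗ[ℂ] C₀(X, ℂ)} {p : SeminormFamily ℂ E ℕ}
  (h : IsRapidlyDecreasing w ι p)

include h

theorem le_seminorm (n : ℕ) (a : E) (x : X) : (w x : ℝ) ^ n * ‖ι a x‖ ≤ p n a := by
  rw [h.seminorm_eq]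
  exact le_ciSup (h.bddAbove a n) x

theorem seminorm_le {n : ℕ} {a : E} {C : ℝ} (hC : 0 ≤ C)
    (hx : ∀ x, (w x : ℝ) ^ n * ‖ι a x‖ ≤ C) : p n a ≤ C := by
  rw [h.seminorm_eq]
  exact Real.iSup_le hx hC

theorem one_le_weight_real (x : X) : (1 : ℝ) ≤ w x := by
  exact_mod_cast h.one_le_weight x

theorem monotone : Monotone p := by
  intro i j hij a
  refine h.seminorm_le (apply_nonneg _ _) fun x => le_trans ?_ (h.le_seminorm j a x)
  exact mul_le_mul_of_nonneg_right (pow_le_pow_right₀ (h.one_le_weight_real x) hij) (norm_nonneg _)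

theorem norm_le_seminorm (a : E) : ‖ι a‖ ≤ p 0 a :=
  ZeroAtInftyContinuousMap.norm_le_of_forall (apply_nonneg _ _) fun x => by
    simpa using h.le_seminorm 0 a x

theorem exists_apply_eq_of_finite_support [DiscreteTopology X] {φ : X → ℂ}
    (hφ : φ.support.Finite) : ∃ a, ⇑(ι a) = φ := by
  obtain ⟨f, rfl⟩ := ZeroAtInftyContinuousMap.exists_coe_eq_of_finite_support hφ
  obtain ⟨a, rfl⟩ := h.exists_eq f fun n => bddAbove_range_of_finite_support hφ _
  exact ⟨a, rfl⟩

/-- A sequence Cauchy for `p 0` converges uniformly in `c₀(X)`. The weighted Cauchy estimates pass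
to the pointwise limit, which therefore lies in `E` and is the limit for every `p n`. -/
theorem isFrechetSpace [TopologicalSpace E] (hp : WithSeminorms p) : IsFrechetSpace E := by
  have := hp.topologicalAddGroup
  have hT1 : T1Space E := hp.T1_of_separating fun a ha => ⟨0, fun h0 => ha ?_⟩
  swap
  · refine h.injective ?_
    rw [map_zero]
    exact norm_le_zero_iff.1 ((h.norm_le_seminorm a).trans h0.le)
  refine ⟨inferInstance, p, h.monotone, hp, fun u hu => ?_⟩
  have hcs : CauchySeq fun i => ι (u i) := by
    refine Metric.cauchySeq_iff.2 fun ε hε => ?_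
    obtain ⟨N, hN⟩ := hu 0 ε hε
    refine ⟨N, fun i hi j hj => ?_⟩
    rw [dist_eq_norm, ← map_sub]
    exact (h.norm_le_seminorm _).trans_lt (hN i hi j hj)
  obtain ⟨g, hg⟩ := cauchySeq_tendsto_of_complete hcs
  have hgx : ∀ x, Tendsto (fun i => ι (u i) x) atTop (𝓝 (g x)) := fun x =>
    (ZeroAtInftyContinuousMap.tendsto_iff_tendstoUniformly.1 hg).tendsto_at x
  have key : ∀ n, ∀ ε > 0, ∃ N, ∀ i ≥ N, ∀ x, (w x : ℝ) ^ n * ‖ι (u i) x - g x‖ ≤ ε := by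
    intro n ε hε
    obtain ⟨N, hN⟩ := hu n ε hε
    refine ⟨N, fun i hi x => ?_⟩
    refine le_of_tendsto (((tendsto_const_nhds.sub (hgx x)).norm).const_mul _)
      (eventually_atTop.2 ⟨N, fun j hj => ?_⟩)
    have := h.le_seminorm n (u i - u j) x
    rw [map_sub, ZeroAtInftyContinuousMap.sub_apply] at this
    exact this.trans (hN i hi j hj).le
  obtain ⟨a, rfl⟩ := h.exists_eq g fun n => by
    obtain ⟨N, hN⟩ := key n 1 one_pos
    refine ⟨p n (u N) + 1, ?_⟩
    rintro _ ⟨x, rfl⟩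
    have h1 := hN N le_rfl x
    have h2 := h.le_seminorm n (u N) x
    have h3 : ‖g x‖ ≤ ‖ι (u N) x‖ + ‖ι (u N) x - g x‖ := by
      have := norm_sub_norm_le (g x) (ι (u N) x)
      rw [norm_sub_rev] at this
      linarith
    have h4 := mul_le_mul_of_nonneg_left h3 (by positivity : (0 : ℝ) ≤ (w x : ℝ) ^ n)
    rw [mul_add] at h4
    show (w x : ℝ) ^ n * ‖g x‖ ≤ _
    linarith
  refine ⟨a, (hp.tendsto_nhds_atTop _ _).2 fun n ε hε => ?_⟩
  obtain ⟨N, hN⟩ := key n (ε / 2) (half_pos hε)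
  refine ⟨N, fun i hi => (h.seminorm_le (half_pos hε).le fun x => ?_).trans_lt (half_lt_self hε)⟩
  rw [map_sub]
  exact hN i hi x

/-- As `p` is monotone, a finite supremum of its members is bounded by the one of largest index. -/
theorem exists_bound_of_continuous [TopologicalSpace E] (hp : WithSeminorms p)
    {r : Seminorm ℂ E} (hr : Continuous r) :
    ∃ (n : ℕ) (C : NNReal), 0 < C ∧ r ≤ C • p n := by
  obtain ⟨s, C, hC, hle⟩ := Seminorm.bound_of_continuous hp r hr
  refine ⟨s.sup id, C, pos_iff_ne_zero.2 hC, fun a => (hle a).trans ?_⟩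
  have hs : s.sup p ≤ p (s.sup id) :=
    Finset.sup_le fun i hi => h.monotone (Finset.le_sup (f := id) hi)
  exact mul_le_mul_of_nonneg_left (hs a) C.2

theorem isNuclearSpace [DiscreteTopology X] [TopologicalSpace E] (hp : WithSeminorms p) :
    IsNuclearSpace E := by
  classical
  intro r hr
  obtain ⟨n, C, hC, hrC⟩ := h.exists_bound_of_continuous hp hr
  have hC' : (0 : ℝ) < C := hC
  have hrC' : ∀ a, r a ≤ C * p n a := hrC
  choose e he using fun x : X => h.exists_apply_eq_of_finite_support (φ := Pi.single x 1)
    ((Set.finite_singleton x).subset Pi.support_single_subset)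
  have hen : ∀ x, p n (e x) ≤ (w x : ℝ) ^ n := fun x => by
    refine h.seminorm_le (by positivity) fun x' => ?_
    rw [he]
    obtain rfl | hx := eq_or_ne x' x
    · simp
    · simp [hx]
  let ev : X → E →ₗ[ℂ] ℂ := fun x =>
    { toFun := fun a => ι a x
      map_add' := fun a b => by simp
      map_smul' := fun c a => by simp }
  -- Indexing by the weight `k = w x`, with zero terms elsewhere, allows comparison with `∑ 1/k²`.
  -- The index `0` is never a weight.
  let f : ℕ → E →ₗ[ℂ] ℂ := Function.extend w ev 0
  let y : ℕ → E := Function.extend w e 0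
  have hf : ∀ x, f (w x) = ev x := fun x => h.weight_injective.extend_apply _ _ x
  have hy : ∀ x, y (w x) = e x := fun x => h.weight_injective.extend_apply _ _ x
  have hf0 : ∀ k, (¬ ∃ x, w x = k) → f k = 0 := fun k hk => Function.extend_apply' _ _ _ hk
  have hy0 : ∀ k, (¬ ∃ x, w x = k) → y k = 0 := fun k hk => Function.extend_apply' _ _ _ hk
  have hwpos : ∀ x, (0 : ℝ) < w x := fun x => zero_lt_one.trans_le (h.one_le_weight_real x)
  -- The factor `C` ensures `r ≤ q`; it is compensated by the division by `C` in the coefficients.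
  refine ⟨C • p (n + 2), (hp.continuous_seminorm (n + 2)).const_smul C,
    hrC.trans fun a => mul_le_mul_of_nonneg_left (h.monotone (Nat.le_add_right n 2) a) C.2,
    f, fun k => ((k : ℝ) ^ (n + 2))⁻¹ / C, y, fun k => by positivity, fun k a => ?_, ?_,
    fun a => ?_⟩
  · show ‖f k a‖ ≤ ((k : ℝ) ^ (n + 2))⁻¹ / C * (C * p (n + 2) a)
    by_cases hk : ∃ x, w x = k
    · obtain ⟨x, rfl⟩ := hk
      rw [hf]
      have h1 := h.le_seminorm (n + 2) a x
      have h2 : (0 : ℝ) < (w x : ℝ) ^ (n + 2) := pow_pos (hwpos x) _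
      calc ‖ι a x‖ ≤ ((w x : ℝ) ^ (n + 2))⁻¹ * p (n + 2) a := by
            rwa [← div_eq_inv_mul, le_div_iff₀' h2]
        _ = _ := by field_simp
    · rw [hf0 k hk]
      simp only [LinearMap.zero_apply, norm_zero]
      positivity
  · refine Summable.of_nonneg_of_le (fun k => by positivity) (fun k => ?_)
      (Real.summable_one_div_nat_pow.2 one_lt_two)
    by_cases hk : ∃ x, w x = k
    · obtain ⟨x, rfl⟩ := hk
      rw [hy]
      have h2 := hwpos x
      calc ((w x : ℝ) ^ (n + 2))⁻¹ / C * r (e x)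
          ≤ ((w x : ℝ) ^ (n + 2))⁻¹ / C * (C * (w x : ℝ) ^ n) := by
            refine mul_le_mul_of_nonneg_left ((hrC' _).trans ?_) (by positivity)
            exact mul_le_mul_of_nonneg_left (hen x) hC'.le
        _ = 1 / (w x : ℝ) ^ 2 := by
            field_simp
            ring
    · rw [hy0 k hk, map_zero, mul_zero]
      positivity
  · have hterm : ∀ k x, f k a * ι (y k) x = if k = w x then ι a x else 0 := by
      intro k x
      by_cases hk : ∃ x', w x' = k
      · obtain ⟨x', rfl⟩ := hk
        rw [hf, hy, he]
        obtain rfl | hx := eq_or_ne x x'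
        · simp [ev]
        · simp [hx, h.weight_injective.ne hx.symm]
      · rw [hf0 k hk, if_neg fun hkx => hk ⟨x, hkx.symm⟩]
        simp
    have hsum : ∀ N x, ι (a - ∑ k ∈ Finset.range N, f k a • y k) x =
        if w x < N then 0 else ι a x := by
      intro N x
      have h1 : ι (∑ k ∈ Finset.range N, f k a • y k) x =
          ∑ k ∈ Finset.range N, f k a * ι (y k) x := by
        induction N with
        | zero => simp
        | succ N ih => rw [Finset.sum_range_succ, Finset.sum_range_succ, ← ih]; simp
      rw [map_sub, ZeroAtInftyContinuousMap.sub_apply, h1]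
      simp only [hterm, Finset.sum_ite_eq', Finset.mem_range]
      split_ifs <;> simp
    -- The remainder lives on `N ≤ w x`, where `w(x)^n ≤ w(x)^(n+1) / N`.
    have hlim : Tendsto (fun N : ℕ => C * (p (n + 1) a / (N : ℝ))) atTop (𝓝 0) := by
      simpa using (tendsto_const_div_atTop_nhds_zero_nat (p (n + 1) a)).const_mul (C : ℝ)
    refine squeeze_zero' (Eventually.of_forall fun N => apply_nonneg _ _) ?_ hlim
    filter_upwards [eventually_ge_atTop 1] with N hN
    have hN0 : (0 : ℝ) < N := by exact_mod_cast hN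
    refine (hrC' _).trans (mul_le_mul_of_nonneg_left ?_ hC'.le)
    refine h.seminorm_le (by positivity) fun x => ?_
    rw [hsum]
    split_ifs with hx
    · simp only [norm_zero, mul_zero]
      positivity
    · have hx' : (N : ℝ) ≤ w x := by exact_mod_cast not_lt.1 hx
      rw [le_div_iff₀ hN0]
      refine le_trans ?_ (h.le_seminorm (n + 1) a x)
      have := mul_le_mul_of_nonneg_left hx'
        (by positivity : 0 ≤ (w x : ℝ) ^ n * ‖ι a x‖)
      exact this.trans (le_of_eq (by ring))

theorem seminorm_le_mul {n : ℕ} {a a' : E} {f : C₀(X, ℂ)} (ha : ι a' = ι a * f) :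
    p n a' ≤ p n a * ‖f‖ := by
  refine h.seminorm_le (by positivity) fun x => ?_
  rw [ha, ZeroAtInftyContinuousMap.mul_apply, norm_mul, ← mul_assoc]
  exact mul_le_mul (h.le_seminorm n a x) (f.norm_apply_le x) (norm_nonneg _) (apply_nonneg _ _)

theorem exists_eq_mul (a : E) (f : C₀(X, ℂ)) : ∃ a', ι a' = ι a * f := by
  refine h.exists_eq _ fun n => ⟨p n a * ‖f‖, ?_⟩
  rintro _ ⟨x, rfl⟩
  show (w x : ℝ) ^ n * ‖ι a x * f x‖ ≤ _
  rw [norm_mul, ← mul_assoc]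
  exact mul_le_mul (h.le_seminorm n a x) (f.norm_apply_le x) (norm_nonneg _) (apply_nonneg _ _)

/-- Cutting `f` off outside the finite set where `|f| ≥ ε/2` changes it by at most `ε/2`. -/
theorem denseRange [DiscreteTopology X] : DenseRange ι := by
  intro f
  refine Metric.mem_closure_iff.2 fun ε hε => ?_
  have hfin : {x | ε / 2 ≤ ‖f x‖}.Finite := by
    have := f.zero_at_infty'
    rw [cocompact_eq_cofinite] at this
    have h1 := (tendsto_order.1 this.norm).2 (ε / 2) (by simpa using half_pos hε)
    refine (Filter.mem_cofinite.1 h1).subset fun x (hx : ε / 2 ≤ ‖f x‖) hx' => ?_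
    exact not_lt.2 hx hx'
  obtain ⟨a, ha⟩ := h.exists_apply_eq_of_finite_support
    (φ := {x | ε / 2 ≤ ‖f x‖}.indicator f) (hfin.subset Set.support_indicator_subset)
  refine ⟨ι a, ⟨a, rfl⟩, ?_⟩
  rw [dist_eq_norm]
  refine (ZeroAtInftyContinuousMap.norm_le_of_forall (half_pos hε).le fun x => ?_).trans_lt
    (half_lt_self hε)
  rw [ZeroAtInftyContinuousMap.sub_apply, ha]
  by_cases hx : x ∈ {x | ε / 2 ≤ ‖f x‖}
  · rw [Set.indicator_of_mem hx, sub_self, norm_zero]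
    exact (half_pos hε).le
  · rw [Set.indicator_of_notMem hx, sub_zero]
    exact (not_le.1 hx).le

end IsRapidlyDecreasing

variable {B : Type*} [NonUnitalNormedRing B] [NormedSpace ℂ B]

theorem IsRapidlyDecreasing.isDenseNuclearFrechetIdeal [DiscreteTopology X]
    (Φ : B ≃ₗᵢ[ℂ] C₀(X, ℂ)) (hΦ : ∀ a b, Φ (a * b) = Φ a * Φ b) {w : X → ℕ}
    {A : NonUnitalSubalgebra ℂ B} {p : SeminormFamily ℂ A ℕ}
    (h : IsRapidlyDecreasing w
      (Φ.toLinearEquiv.toLinearMap ∘ₗ (NonUnitalSubalgebraClass.subtype A : A →ₗ[ℂ] B)) p)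
    (τ : TopologicalSpace A) (hp : @WithSeminorms ℂ A ℕ _ _ _ p τ) :
    IsDenseNuclearFrechetIdeal A τ := by
  have hmem : ∀ (a : A) (b : B), (a : B) * b ∈ A := fun a b => by
    obtain ⟨a', ha'⟩ := h.exists_eq_mul a (Φ b)
    have h1 : Φ (a' : B) = Φ (a * b) := ha'.trans (hΦ _ _).symm
    rw [← Φ.injective h1]
    exact a'.2
  have hcomm : ∀ a b : B, a * b = b * a := fun a b =>
    Φ.injective (by rw [hΦ, hΦ, mul_comm])
  have hmem' : ∀ (a : A) (b : B), b * (a : B) ∈ A := fun a b => hcomm a b ▸ hmem a b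
  have hincl : Continuous[τ, inferInstance] fun a : A => (a : B) := by
    refine @WithSeminorms.continuous_of_norm_le A B _ _ τ _ p _ hp
      (NonUnitalSubalgebraClass.subtype A : A →ₗ[ℂ] B) 0 fun a => ?_
    exact (Φ.norm_map (a : B)).symm.trans_le (h.norm_le_seminorm a)
  have hright : Continuous[@instTopologicalSpaceProd A B τ inferInstance, τ]
      fun x : A × B => (⟨(x.1 : B) * x.2, hmem x.1 x.2⟩ : A) := by
    refine @WithSeminorms.continuous_of_map_mul_le A B _ _ τ _ p hp _
      (fun a a' b => Subtype.ext (sub_mul _ _ _).symm)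
      (fun a b b' => Subtype.ext (mul_sub _ _ _).symm) fun n a b => ?_
    rw [← Φ.norm_map b]
    exact h.seminorm_le_mul (hΦ _ _)
  refine
    { frechet := @IsRapidlyDecreasing.isFrechetSpace _ _ _ _ _ _ _ _ h τ hp
      continuous_mul := ?_
      continuous_incl := hincl
      mul_mem_right := hmem
      mul_mem_left := hmem'
      continuous_mul_right := hright
      continuous_mul_left := ?_
      dense := ?_
      nuclear := @IsRapidlyDecreasing.isNuclearSpace _ _ _ _ _ _ _ _ h _ τ hp }
  -- The product on `A × A` factors through `A × B` via the inclusion.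
  · let := τ
    exact hright.comp (continuous_fst.prodMk (hincl.comp continuous_snd))
  · have h1 : (fun x : A × B => (⟨x.2 * (x.1 : B), hmem' x.1 x.2⟩ : A)) =
        fun x => ⟨(x.1 : B) * x.2, hmem x.1 x.2⟩ := funext fun x => Subtype.ext (hcomm _ _)
    rw [h1]
    exact hright
  · have h1 := Φ.symm.surjective.denseRange.comp h.denseRange Φ.symm.continuous
    refine h1.mono ?_
    rintro _ ⟨a, rfl⟩
    show Φ.symm (Φ a) ∈ A
    rw [Φ.symm_apply_apply]
    exact a.2

end Weighted

/-! ### Standard Schwartz functions -/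

section Schwartz

variable {X : Type*} [TopologicalSpace X] [DiscreteTopology X]

/-- The bound for `n = 1` gives `|φ| ≤ C/γ`, and `γ → ∞` along the cofinite filter. -/
theorem IsSchwartzFunction.exists_mem_schwartzSubalgebra {γ : X ≃ ℕ+} {φ : X → ℂ}
    (hφ : IsSchwartzFunction γ φ) : ∃ f ∈ schwartzSubalgebra γ, ⇑f = φ := by
  obtain ⟨C, hC⟩ := hφ 1
  have hγ : Tendsto (fun x => ((γ x : ℕ) : ℝ)) cofinite atTop :=
    tendsto_natCast_atTop_atTop.comp (Nat.cofinite_eq_atTop ▸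
      (PNat.coe_injective.comp γ.injective).tendsto_cofinite)
  have hlim : Tendsto φ (cocompact X) (𝓝 0) := by
    rw [cocompact_eq_cofinite]
    refine squeeze_zero_norm (fun x => ?_) (hγ.const_div_atTop C)
    have h1 : ((γ x : ℕ) : ℝ) ^ 1 * ‖φ x‖ ≤ C := hC ⟨x, rfl⟩
    rw [le_div_iff₀' (by exact_mod_cast (γ x).pos)]
    simpa using h1
  exact ⟨⟨⟨φ, continuous_of_discreteTopology⟩, hlim⟩, hφ, rfl⟩

theorem isDenseNuclearFrechetIdeal_schwartzSubalgebra (γ : X ≃ ℕ+) :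
    IsDenseNuclearFrechetIdeal (schwartzSubalgebra γ) (schwartzTopology γ) := by
  refine IsRapidlyDecreasing.isDenseNuclearFrechetIdeal (LinearIsometryEquiv.refl ℂ C₀(X, ℂ))
    (fun _ _ => rfl) (w := fun x => (γ x : ℕ)) (p := schwartzNorm γ) ?_ _
    (@WithSeminorms.mk _ _ _ _ _ _ _ (schwartzTopology γ) rfl)
  exact
    { weight_injective := PNat.coe_injective.comp γ.injective
      one_le_weight := fun x => (γ x).pos
      injective := Subtype.val_injective
      bddAbove := fun a n => a.2 n
      exists_eq := fun f hf => ⟨⟨f, hf⟩, rfl⟩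
      seminorm_eq := fun n a => rfl }

end Schwartz

/-! ### The weighted ideal of `B` and sufficiency -/

section Weighted

variable {X : Type*} [TopologicalSpace X] {B : Type*} [NonUnitalNormedRing B] [NormedSpace ℂ B]

/-- The subalgebra of those elements of `B` that become rapidly decreasing, with respect to the
weight `w`, under a homomorphism `Φ` into `c₀(X)`. -/
def weightedSubalgebra (Φ : B →ₙₐ[ℂ] C₀(X, ℂ)) (w : X → ℕ) : NonUnitalSubalgebra ℂ B where
  carrier := {b | ∀ n : ℕ, BddAbove (Set.range fun x => (w x : ℝ) ^ n * ‖Φ b x‖)}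
  zero_mem' n := ⟨0, by rintro _ ⟨x, rfl⟩; simp⟩
  add_mem' {a b} ha hb n := by
    obtain ⟨C, hC⟩ := ha n
    obtain ⟨D, hD⟩ := hb n
    refine ⟨C + D, ?_⟩
    rintro _ ⟨x, rfl⟩
    have h1 := mul_le_mul_of_nonneg_left (norm_add_le (Φ a x) (Φ b x))
      (by positivity : (0 : ℝ) ≤ (w x : ℝ) ^ n)
    rw [mul_add] at h1
    simpa using h1.trans (add_le_add (hC ⟨x, rfl⟩) (hD ⟨x, rfl⟩))
  mul_mem' {a b} ha _ n := by
    obtain ⟨C, hC⟩ := ha n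
    refine ⟨C * ‖Φ b‖, ?_⟩
    rintro _ ⟨x, rfl⟩
    have h1 : (w x : ℝ) ^ n * ‖Φ a x‖ ≤ C := hC ⟨x, rfl⟩
    have h2 := mul_le_mul h1 ((Φ b).norm_apply_le x) (norm_nonneg _)
      ((by positivity : (0 : ℝ) ≤ (w x : ℝ) ^ n * ‖Φ a x‖).trans h1)
    simpa [mul_assoc] using h2
  smul_mem' r b hb n := by
    obtain ⟨C, hC⟩ := hb n
    refine ⟨‖r‖ * C, ?_⟩
    rintro _ ⟨x, rfl⟩
    have h1 := mul_le_mul_of_nonneg_left (hC ⟨x, rfl⟩) (norm_nonneg r)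
    simpa [mul_left_comm] using h1

/-- The weighted sup-norms on `weightedSubalgebra Φ w`. -/
noncomputable def weightedSeminorm (Φ : B →ₙₐ[ℂ] C₀(X, ℂ)) (w : X → ℕ) :
    SeminormFamily ℂ (weightedSubalgebra Φ w) ℕ := fun n =>
  Seminorm.of (fun b => ⨆ x, (w x : ℝ) ^ n * ‖Φ b x‖)
    (fun a b => by
      refine Real.iSup_le (fun x => ?_) (add_nonneg
        (Real.iSup_nonneg fun x => by positivity) (Real.iSup_nonneg fun x => by positivity))
      have h1 := mul_le_mul_of_nonneg_left (norm_add_le (Φ a x) (Φ b x))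
        (by positivity : (0 : ℝ) ≤ (w x : ℝ) ^ n)
      rw [mul_add] at h1
      simpa using h1.trans (add_le_add (le_ciSup (a.2 n) x) (le_ciSup (b.2 n) x)))
    (fun r b => by
      rw [Real.mul_iSup_of_nonneg (norm_nonneg r)]
      refine congrArg _ (funext fun x => ?_)
      simp [mul_left_comm])

end Weighted

section Sufficiency

open WeakDual WeakDual.CharacterSpace

theorem exists_isDenseNuclearFrechetIdeal {B : Type*} [NonUnitalCommCStarAlgebra B]
    [DiscreteTopology (characterSpace ℂ B)] [Countable (characterSpace ℂ B)] :
    ∃ (A : NonUnitalSubalgebra ℂ B) (τ : TopologicalSpace A), IsDenseNuclearFrechetIdeal A τ := by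
  -- An injection covers finite and infinite `M` alike; the shift by one makes the weights positive.
  obtain ⟨g, hg⟩ := exists_injective_nat (characterSpace ℂ B)
  let w : characterSpace ℂ B → ℕ := fun m => g m + 1
  let Ψ : B →ₙₐ[ℂ] C₀(characterSpace ℂ B, ℂ) := (gelfandTransformHom B).toNonUnitalAlgHom
  let Φ : B ≃ₗᵢ[ℂ] C₀(characterSpace ℂ B, ℂ) :=
    { LinearEquiv.ofBijective (Ψ : B →ₗ[ℂ] C₀(characterSpace ℂ B, ℂ))
        gelfandTransformHom_bijective with
      -- Injective ⋆-homomorphisms of C⋆-algebras are isometric.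
      norm_map' := NonUnitalStarAlgHom.norm_map (gelfandTransformHom B)
        gelfandTransformHom_bijective.1 }
  refine ⟨weightedSubalgebra Ψ w, (weightedSeminorm Ψ w).moduleFilterBasis.topology,
    IsRapidlyDecreasing.isDenseNuclearFrechetIdeal Φ (map_mul Ψ) (w := w)
      (p := weightedSeminorm Ψ w) ?_ _ (@WithSeminorms.mk _ _ _ _ _ _ _
        (weightedSeminorm Ψ w).moduleFilterBasis.topology rfl)⟩
  exact
    { weight_injective := fun m m' h => hg (Nat.succ_injective h)
      one_le_weight := fun m => Nat.le_add_left 1 _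
      injective := Φ.injective.comp Subtype.val_injective
      bddAbove := fun a n => a.2 n
      exists_eq := fun f hf => by
        obtain ⟨b, rfl⟩ := gelfandTransformHom_bijective.2 f
        exact ⟨⟨b, hf⟩, rfl⟩
      seminorm_eq := fun n a => rfl }

end Sufficiency

theorem theorem4p3 {B : Type*} [NonUnitalCommCStarAlgebra B] :
    ((∃ (A : NonUnitalSubalgebra ℂ B) (τ : TopologicalSpace A), IsDenseNuclearFrechetIdeal A τ) ↔
      DiscreteTopology (WeakDual.characterSpace ℂ B) ∧
        Countable (WeakDual.characterSpace ℂ B)) ∧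
    (DiscreteTopology (WeakDual.characterSpace ℂ B) →
      Countable (WeakDual.characterSpace ℂ B) →
      Infinite (WeakDual.characterSpace ℂ B) →
      ∃ Φ : B ≃⋆ₐ[ℂ] C₀(WeakDual.characterSpace ℂ B, ℂ),
        ∀ (b : B) (m : WeakDual.characterSpace ℂ B), Φ b m = m b) ∧
    (∀ (X : Type*) [TopologicalSpace X] [DiscreteTopology X] (γ : X ≃ ℕ+),
      (∀ φ : X → ℂ, IsSchwartzFunction γ φ → ∃ f ∈ schwartzSubalgebra γ, ⇑f = φ) ∧
      IsDenseNuclearFrechetIdeal (schwartzSubalgebra γ) (schwartzTopology γ)) := by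
  refine ⟨⟨?_, ?_⟩, fun _ _ _ => ?_, fun X _ _ γ => ⟨fun φ hφ => ?_, ?_⟩⟩
  · rintro ⟨A, τ, h⟩
    exact ⟨h.discreteTopology_characterSpace, h.countable_characterSpace⟩
  · rintro ⟨_, _⟩
    exact exists_isDenseNuclearFrechetIdeal
  · exact ⟨WeakDual.CharacterSpace.gelfandTransformEquiv B,
      WeakDual.CharacterSpace.gelfandTransformEquiv_apply⟩
  · exact hφ.exists_mem_schwartzSubalgebra
  · exact isDenseNuclearFrechetIdeal_schwartzSubalgebra γ
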